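/- Let $R$ be an associative ring with identity, let $n\in\{0,1,2,\dots\}\cup\{\infty\}$; modules are left $R$-modules. Let $\mathcal P^{<n+1}$ be the class of modules $M$ admitting an exact sequence $0\to P_k\to\cdots\to P_0\to M\to 0$ with $k\le n$ ($k$ arbitrary finite if $n=\infty$) and all $P_j$ finitely generated projective. A short exact sequence of modules is $n$-exact if it stays short exact under $\mathrm{Hom}_R(M,-)$ for every $M\in\mathcal P^{<n+1}$; a module $Q$ is $n$-projective if $\mathrm{Hom}_R(Q,-)$ keeps every $n$-exact sequence short exact. A complex $X^\bullet$ is $n$-exact if it is exact and $0\to\mathrm{Ker}\,d^j\to X^j\to\mathrm{Coker}\,d^{j-1}\to 0$ is $n$-exact for every $j\in\mathbb Z$; a cochain map is an $n$-quasi-isomorphism if its mapping cone is $n$-exact. The bounded $n$-derived category $D^b_n(R)$ is the Verdier quotient of the bounded homotopy category $K^b(R)$ by the full subcategory of $n$-exact bounded complexes. An $n$-projective resolution of a complex $X^\bullet$ is an $n$-quasi-isomorphism $P^\bullet\to X^\bullet$, where $P^\bullet$ is a complex of $n$-projective modules such that the complex $\mathrm{Hom}_R(P^\bullet,Y^\bullet)$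 is exact for every $n$-exact complex $Y^\bullet$. For such a resolution put $n\text{-}\mathrm{Ext}^i_R(X^\bullet,Y^\bullet):=H^i\,\mathrm{Hom}_R(P^\bullet,Y^\bullet)$. Modules are regarded as complexes concentrated in degree $0$. **Proposition.** Let $M$ and $N$ be $R$-modules and $i\in\mathbb Z$. Then $M$ has an $n$-projective resolution, and for every $n$-projective resolution $P^\bullet\to M$, used to compute $n\text{-}\mathrm{Ext}$, there is an isomorphism of abelian groups $$n\text{-}\mathrm{Ext}^i_R(M,N)=H^i\,\mathrm{Hom}_R(P^\bullet,N)\;\cong\;\mathrm{Hom}_{D^b_n(R)}(M,N[i]).$$ -/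

import Mathlib

open CategoryTheory Limits Pretriangulated Opposite ZeroObject

universe u

noncomputable section

namespace NDerived

variable {R : Type u} [Ring R]

/-! ### `n`-exact sequences, `n`-projective modules -/

/-- The class of modules `M` admitting an exact sequence
`0 → P_k → ⋯ → P_1 → P_0 → M → 0` with `k ≤ n` and all `P_i` finitely generated projective.
For `n = ⊤` (that is, `n = ∞`) the length `k` is an arbitrary natural number. -/
def FinProjLE (n : ℕ∞) (M : ModuleCat.{u} R) : Prop :=
  ∃ P : ProjectiveResolution M, (∀ j, Module.Finite R (P.complex.X j)) ∧
    ∃ k : ℕ, (k : ℕ∞) ≤ n ∧ ∀ j, k < j → IsZero (P.complex.X j)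

/-- The functor `Hom_R(M, -)` from `R`-modules to abelian groups. -/
abbrev homFrom (M : ModuleCat.{u} R) : ModuleCat.{u} R ⥤ AddCommGrpCat.{u} :=
  preadditiveCoyoneda.obj (op M)

/-- A short exact sequence is `n`-exact if it stays short exact after applying `Hom_R(M, -)`
for every `M` having a resolution of length at most `n` by finitely generated projectives. -/
structure IsNExact (n : ℕ∞) (S : ShortComplex (ModuleCat.{u} R)) : Prop where
  shortExact : S.ShortExact
  shortExact_hom (M : ModuleCat.{u} R) : FinProjLE n M → (S.map (homFrom M)).ShortExact

/-- A module is `n`-projective if it is projective with respect to all `n`-exact sequences. -/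
def IsNProjective (n : ℕ∞) (Q : ModuleCat.{u} R) : Prop :=
  ∀ S : ShortComplex (ModuleCat.{u} R), IsNExact n S → (S.map (homFrom Q)).ShortExact

/-! ### `n`-exact complexes, `n`-quasi-isomorphisms -/

/-- A complex `X` is `n`-exact if it is exact and, for every `i`, the sequence
`0 → Ker d^i → X^i → Coker d^{i-1} → 0` is `n`-exact. (The composition of its two maps vanishes
because `X` is exact.) -/
structure IsNExactComplex (n : ℕ∞) (X : CochainComplex (ModuleCat.{u} R) ℤ) : Prop where
  acyclic : X.Acyclic
  isNExact (i : ℤ) : ∃ w : X.iCycles i ≫ X.pOpcycles i = 0,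
    IsNExact n (ShortComplex.mk (X.iCycles i) (X.pOpcycles i) w)

/-- A cochain map is an `n`-quasi-isomorphism if its mapping cone is `n`-exact. -/
def IsNQuasiIso (n : ℕ∞) {X Y : CochainComplex (ModuleCat.{u} R) ℤ} (f : X ⟶ Y) : Prop :=
  IsNExactComplex n (CochainComplex.mappingCone f)

/-! ### `n`-projective resolutions and relative `Ext` groups -/

/-- An `n`-projective resolution of a complex `X`: an `n`-quasi-isomorphism `P ⟶ X` where `P` is
a complex of `n`-projective modules such that the total Hom complex `Hom_R(P, Y)` is exact for
every `n`-exact complex `Y`. -/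
structure NProjectiveResolution (n : ℕ∞) (X : CochainComplex (ModuleCat.{u} R) ℤ) where
  /-- the complex of `n`-projective modules -/
  complex : CochainComplex (ModuleCat.{u} R) ℤ
  isNProjective (j : ℤ) : IsNProjective n (complex.X j)
  acyclic_hom (Y : CochainComplex (ModuleCat.{u} R) ℤ) : IsNExactComplex n Y →
    (CochainComplex.HomComplex complex Y).Acyclic
  /-- the comparison map -/
  π : complex ⟶ X
  isNQuasiIso : IsNQuasiIso n π

/-- The relative group `n-Ext^i_R(X, Y) = H^i Hom_R(P, Y)`, computed with an `n`-projective
resolution `P` of `X`. -/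
abbrev NProjectiveResolution.nExt {n : ℕ∞} {X : CochainComplex (ModuleCat.{u} R) ℤ}
    (P : NProjectiveResolution n X) (Y : CochainComplex (ModuleCat.{u} R) ℤ) (i : ℤ) :
    AddCommGrpCat.{u} :=
  (CochainComplex.HomComplex P.complex Y).homology i

/-! ### `n`-exact complexes form a triangulated subcategory of the homotopy category -/

lemma finProjLE_self (n : ℕ∞) : FinProjLE n (ModuleCat.of R R) := by
  have : Projective (ModuleCat.of R R) := by
    rw [← IsProjective.iff_projective]; infer_instance
  refine ⟨ProjectiveResolution.self _, fun j => ?_, 0, by simp, fun j hj => ?_⟩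
  · rcases j with _ | j
    · exact inferInstanceAs (Module.Finite R R)
    · have h : IsZero ((ProjectiveResolution.self (ModuleCat.of R R)).complex.X (j + 1)) :=
        HomologicalComplex.isZero_single_obj_X _ _ _ _ (by simp)
      have := ModuleCat.subsingleton_of_isZero h
      infer_instance
  · exact HomologicalComplex.isZero_single_obj_X _ _ _ _ (by omega)

lemma exact_map_homFrom_iff (S : ShortComplex (ModuleCat.{u} R)) (M : ModuleCat.{u} R) :
    (S.map (homFrom M)).Exact ↔
      ∀ φ : M ⟶ S.X₂, φ ≫ S.g = 0 → ∃ ψ : M ⟶ S.X₁, ψ ≫ S.f = φ := by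
  rw [ShortComplex.ab_exact_iff]
  rfl

lemma shortExact_map_homFrom_iff {S : ShortComplex (ModuleCat.{u} R)} (hS : S.ShortExact)
    (M : ModuleCat.{u} R) : (S.map (homFrom M)).ShortExact ↔
      ∀ φ : M ⟶ S.X₃, ∃ ψ : M ⟶ S.X₂, ψ ≫ S.g = φ := by
  have := hS.mono_f
  refine ⟨fun h => (AddCommGrpCat.epi_iff_surjective _).1 h.epi_g, fun h => ?_⟩
  have h₁ : Mono (S.map (homFrom M)).f := by
    rw [AddCommGrpCat.mono_iff_injective]
    intro (a : M ⟶ S.X₁) (b : M ⟶ S.X₁) hab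
    exact (cancel_mono S.f).1 hab
  have h₂ : Epi (S.map (homFrom M)).g := by
    rw [AddCommGrpCat.epi_iff_surjective]
    exact h
  exact { exact := (exact_map_homFrom_iff S M).2
            fun φ hφ => ⟨hS.exact.lift φ hφ, hS.exact.lift_f φ hφ⟩ }

lemma acyclic_homFrom_iff (X : CochainComplex (ModuleCat.{u} R) ℤ) (M : ModuleCat.{u} R) :
    (((homFrom M).mapHomologicalComplex (ComplexShape.up ℤ)).obj X).Acyclic ↔
      ∀ i j k : ℤ, i + 1 = j → j + 1 = k → ∀ φ : M ⟶ X.X j, φ ≫ X.d j k = 0 →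
        ∃ ψ : M ⟶ X.X i, ψ ≫ X.d i j = φ := by
  have key : ∀ i j k : ℤ, i + 1 = j → j + 1 = k →
      ((((homFrom M).mapHomologicalComplex (ComplexShape.up ℤ)).obj X).ExactAt j ↔
        ∀ φ : M ⟶ X.X j, φ ≫ X.d j k = 0 → ∃ ψ : M ⟶ X.X i, ψ ≫ X.d i j = φ) := by
    intro i j k hi hk
    rw [HomologicalComplex.exactAt_iff' _ i j k (by simp; omega) (by simp; omega)]
    exact exact_map_homFrom_iff (X.sc' i j k) M
  refine ⟨fun h i j k hi hk => (key i j k hi hk).1 (h j), fun h j => ?_⟩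
  exact (key (j - 1) j (j + 1) (by omega) rfl).2 (h _ _ _ (by omega) rfl)

lemma shortExact_cycles_opcycles {X : CochainComplex (ModuleCat.{u} R) ℤ} (hX : X.Acyclic) (i : ℤ) :
    ∃ w : X.iCycles i ≫ X.pOpcycles i = 0,
      (ShortComplex.mk (X.iCycles i) (X.pOpcycles i) w).ShortExact := by
  have w : X.iCycles i ≫ X.pOpcycles i = 0 :=
    ((X.sc i).exact_iff_iCycles_pOpcycles_zero).1 (hX i)
  have hm : Mono (X.sc i).fromOpcycles := (hX i).mono_fromOpcycles
  refine ⟨w, { exact := ?_, mono_f := ?_, epi_g := ?_ }⟩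
  · apply ShortComplex.exact_of_f_is_kernel
    refine KernelFork.IsLimit.ofι' _ _ (fun {A} a ha => ?_)
    have ha' : a ≫ (X.sc i).g = 0 := by
      rw [← (X.sc i).p_fromOpcycles]
      exact (reassoc_of% ha) _ |>.trans zero_comp
    exact ⟨(X.sc i).liftCycles a ha', (X.sc i).liftCycles_i a ha'⟩
  · dsimp; infer_instance
  · dsimp; infer_instance

/-- A complex is `n`-exact if and only if it becomes exact after applying `Hom_R(M, -)`
for all `M` in the class used to define `n`-exact sequences. -/
lemma isNExactComplex_iff (n : ℕ∞) (X : CochainComplex (ModuleCat.{u} R) ℤ) :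
    IsNExactComplex n X ↔ ∀ M : ModuleCat.{u} R, FinProjLE n M →
      (((homFrom M).mapHomologicalComplex (ComplexShape.up ℤ)).obj X).Acyclic := by
  constructor
  · rintro ⟨hX, h⟩ M hM
    rw [acyclic_homFrom_iff]
    intro i j k hi hk φ hφ
    obtain ⟨w, hw⟩ := h i
    have hs := (shortExact_map_homFrom_iff hw.shortExact M).1 (hw.shortExact_hom M hM)
    have hex : (X.sc' i j k).Exact := by
      rw [← X.exactAt_iff' i j k (by simp; omega) (by simp; omega)]
      exact hX j
    let T : ShortComplex (ModuleCat.{u} R) :=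
      ShortComplex.mk (X.fromOpcycles i j) (X.d j k) (by simp)
    let α : X.sc' i j k ⟶ T := 
      { τ₁ := X.pOpcycles i
        τ₂ := 𝟙 _
        τ₃ := 𝟙 _
        comm₁₂ := (X.p_fromOpcycles i j).trans (Category.comp_id _).symm
        comm₂₃ := (Category.id_comp _).trans (Category.comp_id _).symm }
    have : Epi α.τ₁ := inferInstanceAs (Epi (X.pOpcycles i))
    have : IsIso α.τ₂ := inferInstanceAs (IsIso (𝟙 _))
    have : Mono α.τ₃ := inferInstanceAs (Mono (𝟙 _))
    have hT : T.Exact := (ShortComplex.exact_iff_of_epi_of_isIso_of_mono α).1 hex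
    have hf : Mono T.f := by
      obtain rfl : (ComplexShape.up ℤ).next i = j := by simp; omega
      exact (hX i).mono_fromOpcycles
    obtain ⟨ψ, hψ⟩ := hs (hT.lift φ hφ)
    refine ⟨ψ, ?_⟩
    have h1 : hT.lift φ hφ ≫ X.fromOpcycles i j = φ := hT.lift_f φ hφ
    rw [← h1, ← hψ]
    simp
  · intro h
    have hX : X.Acyclic := by
      intro j
      rw [X.exactAt_iff' (j - 1) j (j + 1) (by simp) (by simp), ShortComplex.moduleCat_exact_iff]
      intro (x : X.X j) hx
      obtain ⟨ψ, hψ⟩ := (acyclic_homFrom_iff X _).1 (h _ (finProjLE_self n)) (j - 1) j (j + 1)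
        (by omega) rfl (ModuleCat.ofHom (LinearMap.toSpanSingleton R (X.X j) x)) (by
          ext
          simpa using! hx)
      refine ⟨ψ (1 : R), ?_⟩
      have := ConcreteCategory.congr_hom hψ (1 : R)
      simpa using! this
    refine ⟨hX, fun i => ?_⟩
    obtain ⟨w, hw⟩ := shortExact_cycles_opcycles hX i
    refine ⟨w, hw, fun M hM => ?_⟩
    rw [shortExact_map_homFrom_iff hw]
    intro φ
    have hm : Mono (X.fromOpcycles i (i + 1)) := by
      have := (hX i).mono_fromOpcycles
      have e : (ComplexShape.up ℤ).next i = i + 1 := by simp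
      rw [← e]
      exact this
    obtain ⟨ψ, hψ⟩ : ∃ ψ : M ⟶ X.X i, ψ ≫ X.d i (i + 1) = φ ≫ X.fromOpcycles i (i + 1) := by
      obtain ⟨a, ha⟩ := (acyclic_homFrom_iff X _).1 (h M hM) i (i + 1) (i + 1 + 1) rfl rfl
        (φ ≫ X.fromOpcycles i (i + 1)) (by simp)
      exact ⟨a, ha⟩
    refine ⟨ψ, ?_⟩
    rw [← cancel_mono (X.fromOpcycles i (i + 1))]
    simpa using hψ

variable (R) in
/-- The homotopy category `K(R)` of complexes of `R`-modules. -/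
abbrev K : Type (u + 1) := HomotopyCategory (ModuleCat.{u} R) (ComplexShape.up ℤ)

variable (R) in
/-- The objects of `K(R)` which are `n`-exact complexes. -/
def nExact (n : ℕ∞) : ObjectProperty (K R) := fun X => IsNExactComplex n X.as

lemma nExact_eq (n : ℕ∞) (X : K R) : nExact R n X ↔ ∀ M : ModuleCat.{u} R, FinProjLE n M →
    (HomotopyCategory.subcategoryAcyclic AddCommGrpCat.{u}).inverseImage
      ((homFrom M).mapHomotopyCategory (ComplexShape.up ℤ)) X := by
  refine (isNExactComplex_iff n X.as).trans (forall₂_congr fun M _ => ?_)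
  exact (HomotopyCategory.quotient_obj_mem_subcategoryAcyclic_iff_acyclic
    (((homFrom M).mapHomologicalComplex (ComplexShape.up ℤ)).obj X.as)).symm

instance (n : ℕ∞) : (nExact R n).IsClosedUnderIsomorphisms where
  of_iso e h := (nExact_eq n _).2 fun M hM =>
    ObjectProperty.prop_of_iso _ e ((nExact_eq n _).1 h M hM)

instance (n : ℕ∞) : (nExact R n).IsTriangulated where
  exists_zero := ⟨0, isZero_zero (K R), (nExact_eq n _).2 fun _ _ =>
    ObjectProperty.prop_zero _⟩
  isStableUnderShiftBy a := ⟨fun _ h => (nExact_eq n _).2 fun M hM =>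
    ObjectProperty.le_shift _ a _ ((nExact_eq n _).1 h M hM)⟩
  toIsTriangulatedClosed₂ := .mk' fun T hT h₁ h₃ => (nExact_eq n _).2 fun M hM =>
    ObjectProperty.ext_of_isTriangulatedClosed₂ _ T hT
      ((nExact_eq n _).1 h₁ M hM) ((nExact_eq n _).1 h₃ M hM)

/-! ### The bounded homotopy category -/

variable (R) in
/-- The objects of `K(R)` which are bounded complexes. -/
def bounded : ObjectProperty (K R) :=
  fun X => (∃ a : ℤ, CochainComplex.IsStrictlyGE X.as a) ∧
    ∃ b : ℤ, CochainComplex.IsStrictlyLE X.as b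

instance : (bounded R).ContainsZero where
  exists_zero := ⟨(HomotopyCategory.quotient _ _).obj 0, Functor.map_isZero _ (isZero_zero _),
    ⟨0, inferInstanceAs (CochainComplex.IsStrictlyGE (0 : CochainComplex (ModuleCat.{u} R) ℤ) 0)⟩,
    ⟨0, inferInstanceAs (CochainComplex.IsStrictlyLE (0 : CochainComplex (ModuleCat.{u} R) ℤ) 0)⟩⟩

instance : (bounded R).IsStableUnderShift ℤ where
  isStableUnderShiftBy n :=
    { le_shift := by
        intro X h
        obtain ⟨X : CochainComplex _ _, rfl⟩ := X.quotient_obj_surjective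
        obtain ⟨⟨a, ha⟩, b, hb⟩ := h
        have : CochainComplex.IsStrictlyGE X a := ha
        have : CochainComplex.IsStrictlyLE X b := hb
        rw [ObjectProperty.prop_shift_iff, HomotopyCategory.shift_quotient_obj]
        exact ⟨⟨a - n, CochainComplex.isStrictlyGE_shift X a n (a - n) (by omega)⟩,
          b - n, CochainComplex.isStrictlyLE_shift X b n (b - n) (by omega)⟩ }

instance : (bounded R).IsTriangulatedClosed₃ where
  ext₃' T hT h₁ h₂ := by
    obtain ⟨⟨a₁, ha₁⟩, b₁, hb₁⟩ := h₁
    obtain ⟨⟨a₂, ha₂⟩, b₂, hb₂⟩ := h₂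
    obtain ⟨f : T.obj₁.as ⟶ T.obj₂.as, hf⟩ :=
      (HomotopyCategory.quotient _ _).map_surjective T.mor₁
    refine ⟨(HomotopyCategory.quotient _ _).obj (CochainComplex.mappingCone f), ⟨?_, ?_⟩,
      ⟨Triangle.π₃.mapIso (isoTriangleOfIso₁₂ T _ hT
        (HomotopyCategory.mappingCone_triangleh_distinguished f) (Iso.refl _) (Iso.refl _) ?_)⟩⟩
    · exact ⟨min (a₁ - 1) a₂, CochainComplex.isStrictlyGE_mappingCone f a₁ a₂ _
        (by omega) (by omega)⟩
    · refine ⟨max b₁ b₂, (CochainComplex.isStrictlyLE_iff _ _).2 fun i hi => ?_⟩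
      exact (CochainComplex.mappingCone.isZero_X_iff f i).2
        ⟨CochainComplex.isZero_of_isStrictlyLE T.obj₁.as b₁ _ (by omega),
          CochainComplex.isZero_of_isStrictlyLE T.obj₂.as b₂ _ (by omega)⟩
    · exact (Category.comp_id _).trans (hf.symm.trans (Category.id_comp _).symm)

instance : (bounded R).IsTriangulated where
  toIsTriangulatedClosed₂ := .of_isTriangulatedClosed₃

variable (R) in
/-- The bounded homotopy category `K^b(R)`. -/
abbrev Kb : Type (u + 1) := (bounded R).FullSubcategory

/-! ### The bounded `n`-derived category -/

variable (R) in
/-- The class of morphisms of `K^b(R)` whose cone is an `n`-exact complex. -/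
abbrev nQuasiIso (n : ℕ∞) : MorphismProperty (Kb R) :=
  ((nExact R n).inverseImage (bounded R).ι).trW

variable (R) in
/-- The bounded `n`-derived category `D^b_n(R)`: the Verdier quotient of `K^b(R)` by
its full triangulated subcategory of `n`-exact complexes. -/
abbrev Db (n : ℕ∞) : Type (u + 1) := (nQuasiIso R n).Localization

/-- The complex with the module `M` in degree `0`. -/
abbrev stalk (M : ModuleCat.{u} R) : CochainComplex (ModuleCat.{u} R) ℤ :=
  (CochainComplex.singleFunctor (ModuleCat.{u} R) 0).obj M

/-- A module, regarded as an object of `K^b(R)`. -/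
def stalkKb (M : ModuleCat.{u} R) : Kb R where
  obj := (HomotopyCategory.quotient _ _).obj (stalk M)
  property := ⟨⟨0, inferInstanceAs ((stalk M).IsStrictlyGE 0)⟩,
    ⟨0, inferInstanceAs ((stalk M).IsStrictlyLE 0)⟩⟩

/-- A module, regarded as an object of `D^b_n(R)`. -/
abbrev stalkDb (n : ℕ∞) (M : ModuleCat.{u} R) : Db R n := (nQuasiIso R n).Q.obj (stalkKb M)

end NDerived

end

noncomputable section

namespace NDerived

variable {R : Type u} [Ring R]

/-! ### `n`-projective modules -/

/-! Existence. Modules in $\mathcal P^{<n+1}$ are finitely generated, so they form a set up to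
isomorphism, and the coproduct of all maps from them to $M$ is an $n$-projective cover through which
every such map factors. Covering kernels repeatedly gives a complex of $n$-projectives in degrees
$\le 0$ whose augmentation has an $n$-exact cone, since $n$-exactness can be tested by
$\mathrm{Hom}(A,-)$ with $A\in\mathcal P^{<n+1}$ (`isNExactComplex_iff`). Maps from a bounded above
complex of $n$-projectives to an $n$-exact complex are null-homotopic
(`IsNExactComplex.nonempty_homotopy_zero`), so the Hom complexes are acyclic.

Comparison. $H^i\mathrm{Hom}(P,N)=\mathrm{Hom}_{K(R)}(P,N[i])$, and a Verdier quotient does not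
change morphisms out of a left orthogonal object. But $P$ need not be bounded, so $D^b_n(R)$ is
first embedded fully faithfully in the quotient of $K(R)$ by `nExactMinus`. Bounded above complexes
are used because a map from such an $n$-exact complex to a bounded one factors through a canonical
truncation that is bounded and still $n$-exact. The cover resolution has a bounded above cone, so it
becomes an isomorphism in this quotient (`homAddEquivDb`); any other resolution is homotopy
equivalent to it. -/

lemma isNProjective_iff (n : ℕ∞) (Q : ModuleCat.{u} R) :
    IsNProjective n Q ↔ ∀ S : ShortComplex (ModuleCat.{u} R), IsNExact n S →
      ∀ φ : Q ⟶ S.X₃, ∃ ψ : Q ⟶ S.X₂, ψ ≫ S.g = φ :=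
  forall₂_congr fun _ hS => shortExact_map_homFrom_iff hS.shortExact Q

lemma FinProjLE.isNProjective {n : ℕ∞} {M : ModuleCat.{u} R} (hM : FinProjLE n M) :
    IsNProjective n M :=
  fun _ hS => hS.shortExact_hom M hM

lemma IsNProjective.of_iso {n : ℕ∞} {Q Q' : ModuleCat.{u} R} (e : Q ≅ Q')
    (hQ : IsNProjective n Q) : IsNProjective n Q' := by
  rw [isNProjective_iff] at hQ ⊢
  intro S hS φ
  obtain ⟨ψ, hψ⟩ := hQ S hS (e.hom ≫ φ)
  exact ⟨e.inv ≫ ψ, by simp [hψ]⟩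

lemma IsNProjective.of_isZero {n : ℕ∞} {Q : ModuleCat.{u} R} (hQ : IsZero Q) :
    IsNProjective n Q :=
  (isNProjective_iff n Q).2 fun _ _ _ => ⟨0, hQ.eq_of_src _ _⟩

lemma IsNProjective.sigma {n : ℕ∞} {ι : Type u} (Q : ι → ModuleCat.{u} R)
    (hQ : ∀ i, IsNProjective n (Q i)) : IsNProjective n (∐ Q) := by
  rw [isNProjective_iff]
  intro S hS φ
  choose ψ hψ using fun i => (isNProjective_iff n (Q i)).1 (hQ i) S hS (Sigma.ι Q i ≫ φ)
  exact ⟨Sigma.desc ψ, Sigma.hom_ext _ _ fun i => by simp [hψ]⟩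

/-- Makes the class essentially small, so that covers can be coproducts indexed by a type in the
universe of $R$. -/
lemma FinProjLE.finite {n : ℕ∞} {M : ModuleCat.{u} R} (hM : FinProjLE n M) :
    Module.Finite R M := by
  obtain ⟨P, hP, -⟩ := hM
  have := hP 0
  have : Epi (P.π.f 0) := inferInstance
  exact Module.Finite.of_surjective
    (P.π.f 0 ≫ (HomologicalComplex.singleObjXSelf (ComplexShape.down ℕ) 0 M).hom).hom
    ((ModuleCat.epi_iff_surjective _).1 inferInstance)

/-! ### Covers by modules having finite resolutions -/

/-- The morphisms to `M` from representatives of the isomorphism classes of modules having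
a resolution of length at most `n` by finitely generated projectives. -/
structure CoverIndex (n : ℕ∞) (M : ModuleCat.{u} R) : Type u where
  /-- the number of generators of the source -/
  rank : ℕ
  /-- the module of relations of the source -/
  relations : Submodule R (Fin rank → R)
  exists_iso : ∃ A : ModuleCat.{u} R, FinProjLE n A ∧
    Nonempty (A ≅ ModuleCat.of R ((Fin rank → R) ⧸ relations))
  /-- the morphism to `M` -/
  hom : ModuleCat.of R ((Fin rank → R) ⧸ relations) ⟶ M

/-- The source of a morphism in `CoverIndex n M`. -/
abbrev CoverIndex.source {n : ℕ∞} {M : ModuleCat.{u} R} (i : CoverIndex n M) : ModuleCat.{u} R :=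
  ModuleCat.of R ((Fin i.rank → R) ⧸ i.relations)

/-- The coproduct of all modules over `M` having a resolution of length at most `n` by finitely
generated projectives. -/
def cover (n : ℕ∞) (M : ModuleCat.{u} R) : ModuleCat.{u} R :=
  ∐ fun i : CoverIndex n M => i.source

/-- The canonical morphism from the cover. -/
def coverπ (n : ℕ∞) (M : ModuleCat.{u} R) : cover n M ⟶ M :=
  Sigma.desc fun i : CoverIndex n M => i.hom

/-- The inclusion of a summand of the cover. -/
def coverι {n : ℕ∞} {M : ModuleCat.{u} R} (i : CoverIndex n M) : i.source ⟶ cover n M :=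
  Sigma.ι (fun i : CoverIndex n M => i.source) i

lemma coverι_π {n : ℕ∞} {M : ModuleCat.{u} R} (i : CoverIndex n M) :
    coverι i ≫ coverπ n M = i.hom :=
  Sigma.ι_desc _ _

lemma isNProjective_cover (n : ℕ∞) (M : ModuleCat.{u} R) : IsNProjective n (cover n M) := by
  refine IsNProjective.sigma _ fun i => ?_
  obtain ⟨A, hA, ⟨e⟩⟩ := i.exists_iso
  exact hA.isNProjective.of_iso e

/-- Up to an isomorphism $A\cong R^k/L$, the map $\varphi$ is itself one of the indices of the
cover, so it lifts to the corresponding summand. -/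
lemma FinProjLE.exists_lift_coverπ {n : ℕ∞} {A : ModuleCat.{u} R} (hA : FinProjLE n A)
    {M : ModuleCat.{u} R} (φ : A ⟶ M) : ∃ ψ : A ⟶ cover n M, ψ ≫ coverπ n M = φ := by
  have := hA.finite
  obtain ⟨k, f, hf⟩ := Module.Finite.exists_fin' R A
  let e : A ≅ ModuleCat.of R ((Fin k → R) ⧸ LinearMap.ker f) :=
    (f.quotKerEquivOfSurjective hf).symm.toModuleIso
  obtain ⟨i, g, hg⟩ : ∃ (i : CoverIndex n M) (g : A ⟶ i.source), g ≫ i.hom = φ :=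
    ⟨⟨k, LinearMap.ker f, ⟨A, hA, ⟨e⟩⟩, e.inv ≫ φ⟩, e.hom, e.hom_inv_id_assoc φ⟩
  exact ⟨g ≫ coverι i, by rw [Category.assoc, coverι_π, hg]⟩

/-! ### The resolution by covers -/

/-- A cover of the kernel of `f`. -/
abbrev coverSyzygy (n : ℕ∞) {X Y : ModuleCat.{u} R} (f : X ⟶ Y) : ModuleCat.{u} R :=
  cover n (kernel f)

/-- The morphism from the cover of the kernel of `f` to the source of `f`. -/
abbrev coverD (n : ℕ∞) {X Y : ModuleCat.{u} R} (f : X ⟶ Y) : coverSyzygy n f ⟶ X :=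
  coverπ n (kernel f) ≫ kernel.ι f

lemma FinProjLE.exists_lift_coverD {n : ℕ∞} {A : ModuleCat.{u} R} (hA : FinProjLE n A)
    {X Y : ModuleCat.{u} R} (f : X ⟶ Y) (φ : A ⟶ X) (hφ : φ ≫ f = 0) :
    ∃ ψ : A ⟶ coverSyzygy n f, ψ ≫ coverD n f = φ := by
  obtain ⟨ψ, hψ⟩ := hA.exists_lift_coverπ (kernel.lift f φ hφ)
  exact ⟨ψ, by simp [reassoc_of% hψ]⟩

/-- The resolution of `M` obtained by iterated covers of kernels. -/
def coverComplex (n : ℕ∞) (M : ModuleCat.{u} R) : ChainComplex (ModuleCat.{u} R) ℕ :=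
  ChainComplex.mk' (cover n M) (coverSyzygy n (coverπ n M)) (coverD n (coverπ n M))
    (fun f => ⟨_, coverD n f, by simp⟩)

/-- The augmentation of the resolution by covers. -/
def coverComplexπ (n : ℕ∞) (M : ModuleCat.{u} R) : (coverComplex n M).X 0 ⟶ M :=
  coverπ n M

lemma coverComplex_d_one (n : ℕ∞) (M : ModuleCat.{u} R) :
    (coverComplex n M).d 1 0 = coverD n (coverπ n M) := by
  simp [coverComplex]

lemma coverComplex_d_comp_π (n : ℕ∞) (M : ModuleCat.{u} R) :
    (coverComplex n M).d 1 0 ≫ coverComplexπ n M = 0 := by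
  rw [coverComplex_d_one]
  exact (Category.assoc _ _ _).trans ((_ ≫= kernel.condition _).trans comp_zero)

lemma isNProjective_coverComplex_X (n : ℕ∞) (M : ModuleCat.{u} R) (j : ℕ) :
    IsNProjective n ((coverComplex n M).X j) := by
  -- Every term is a cover by definition; splitting off the low degrees lets the recursion unfold.
  obtain (_ | _ | _ | j) := j <;> apply isNProjective_cover

lemma FinProjLE.exists_lift_coverComplexπ {n : ℕ∞} {A : ModuleCat.{u} R} (hA : FinProjLE n A)
    {M : ModuleCat.{u} R} (φ : A ⟶ M) :
    ∃ ψ : A ⟶ (coverComplex n M).X 0, ψ ≫ coverComplexπ n M = φ :=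
  hA.exists_lift_coverπ φ

lemma FinProjLE.exists_lift_coverComplex_d_one {n : ℕ∞} {A : ModuleCat.{u} R} (hA : FinProjLE n A)
    {M : ModuleCat.{u} R} (φ : A ⟶ (coverComplex n M).X 0) (hφ : φ ≫ coverComplexπ n M = 0) :
    ∃ ψ : A ⟶ (coverComplex n M).X 1, ψ ≫ (coverComplex n M).d 1 0 = φ := by
  rw [coverComplex_d_one]
  exact hA.exists_lift_coverD (coverπ n M) φ hφ

lemma FinProjLE.exists_lift_coverComplex_d {n : ℕ∞} {A : ModuleCat.{u} R} (hA : FinProjLE n A)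
    {M : ModuleCat.{u} R} (j : ℕ) (φ : A ⟶ (coverComplex n M).X (j + 1))
    (hφ : φ ≫ (coverComplex n M).d (j + 1) j = 0) :
    ∃ ψ : A ⟶ (coverComplex n M).X (j + 2), ψ ≫ (coverComplex n M).d (j + 2) (j + 1) = φ := by
  obtain ⟨ψ, hψ⟩ := hA.exists_lift_coverD ((coverComplex n M).d (j + 1) j) φ hφ
  let e : (coverComplex n M).X (j + 2) ≅ coverSyzygy n ((coverComplex n M).d (j + 1) j) := by
    apply ChainComplex.mk'XIso
  have hd : (coverComplex n M).d (j + 2) (j + 1) =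
      e.hom ≫ coverD n ((coverComplex n M).d (j + 1) j) := by
    apply ChainComplex.mk'_d
  exact ⟨ψ ≫ e.inv, by simp [hd, hψ]⟩

/-! ### Maps from bounded above complexes of `n`-projectives to `n`-exact complexes -/

/-- By exactness, $\mathrm{Coker}\,d^{i-1}\to Y^j$ is a kernel of $d^j$, so $\varphi$ factors
through this cokernel; the $n$-exact sequence in degree $i$ then lifts it to $Y^i$. -/
lemma IsNExactComplex.exists_lift {n : ℕ∞} {Y : CochainComplex (ModuleCat.{u} R) ℤ}
    (hY : IsNExactComplex n Y) {Q : ModuleCat.{u} R} (hQ : IsNProjective n Q) (i j k : ℤ)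
    (hij : i + 1 = j) (hjk : j + 1 = k) (φ : Q ⟶ Y.X j) (hφ : φ ≫ Y.d j k = 0) :
    ∃ ψ : Q ⟶ Y.X i, ψ ≫ Y.d i j = φ := by
  obtain ⟨w, hw⟩ := hY.isNExact i
  have hs := (shortExact_map_homFrom_iff hw.shortExact Q).1 (hQ _ hw)
  have e : (ComplexShape.up ℤ).next i = j := by simpa using hij
  have hex : (ShortComplex.mk (Y.fromOpcycles i j) (Y.d j k) (by simp)).Exact := by
    have h := hY.acyclic j
    rw [Y.exactAt_iff' i j k (by simp; omega) (by simp; omega)] at h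
    let α : Y.sc' i j k ⟶ ShortComplex.mk (Y.fromOpcycles i j) (Y.d j k) (by simp) :=
      { τ₁ := Y.pOpcycles i
        τ₂ := 𝟙 _
        τ₃ := 𝟙 _
        comm₁₂ := (Y.p_fromOpcycles i j).trans (Category.comp_id _).symm
        comm₂₃ := (Category.id_comp _).trans (Category.comp_id _).symm }
    have : Epi α.τ₁ := inferInstanceAs (Epi (Y.pOpcycles i))
    have : IsIso α.τ₂ := inferInstanceAs (IsIso (𝟙 _))
    have : Mono α.τ₃ := inferInstanceAs (Mono (𝟙 _))
    exact (ShortComplex.exact_iff_of_epi_of_isIso_of_mono α).1 h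
  have hm : Mono (Y.fromOpcycles i j) := by
    subst e
    exact (hY.acyclic i).mono_fromOpcycles
  have hm' : Mono (ShortComplex.mk (Y.fromOpcycles i j) (Y.d j k) (by simp)).f := hm
  obtain ⟨ψ, hψ⟩ := hs (hex.lift φ hφ)
  refine ⟨ψ, ?_⟩
  have h1 : hex.lift φ hφ ≫ Y.fromOpcycles i j = φ := hex.lift_f φ hφ
  rw [← h1, ← hψ]
  simp

open CochainComplex CochainComplex.HomComplex

/-- A partial homotopy to zero, defined in degrees `≥ m + 1`, extends to degree `m`. -/
lemma IsNExactComplex.exists_extend_homotopy {n : ℕ∞} {P Y : CochainComplex (ModuleCat.{u} R) ℤ}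
    (hP : ∀ j, IsNProjective n (P.X j)) (hY : IsNExactComplex n Y) (f : P ⟶ Y)
    (α : Cochain P Y (-1)) (m : ℤ)
    (hα : ∀ p, m < p → (δ (-1) 0 α).v p p (add_zero p) = f.f p) :
    ∃ β : Cochain P Y (-1), (∀ p q (hpq : p + (-1) = q), m < p → β.v p q hpq = α.v p q hpq) ∧
      ∀ p, m ≤ p → (δ (-1) 0 β).v p p (add_zero p) = f.f p := by
  have hδ (γ : Cochain P Y (-1)) (p : ℤ) : (δ (-1) 0 γ).v p p (add_zero p) =
      γ.v p (p - 1) (by omega) ≫ Y.d (p - 1) p +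
        P.d p (p + 1) ≫ γ.v (p + 1) p (by omega) := by
    rw [δ_v (-1) 0 (neg_add_cancel 1) γ p p (add_zero p) (p - 1) (p + 1) rfl rfl]
    simp
  -- The part of $f^m$ not yet accounted for is a cocycle, by the homotopy relation in degree $m+1$.
  have hu : (f.f m - P.d m (m + 1) ≫ α.v (m + 1) m (by omega)) ≫ Y.d m (m + 1) = 0 := by
    have h := hα (m + 1) (by omega)
    rw [δ_v (-1) 0 (neg_add_cancel 1) α (m + 1) (m + 1) (add_zero _) m (m + 1 + 1)
      (by omega) rfl] at h
    have h' := P.d m (m + 1) ≫= h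
    simp only [Int.negOnePow_zero, one_smul, Preadditive.comp_add,
      HomologicalComplex.d_comp_d_assoc, zero_comp, add_zero] at h'
    rw [Preadditive.sub_comp, Category.assoc, h', f.comm, sub_self]
  obtain ⟨s, hs⟩ := hY.exists_lift (hP m) (m - 1) m (m + 1) (by omega) rfl _ hu
  -- Only the component $P^m\to Y^{m-1}$ changes; it becomes $s$.
  refine ⟨Cochain.mk fun p q hpq => if h : p = m then
      eqToHom (by rw [h]) ≫ s ≫ eqToHom (by rw [← hpq, h]; rfl) else α.v p q hpq, ?_, ?_⟩
  · intro p q hpq hp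
    rw [Cochain.mk_v, dif_neg (by omega)]
  · intro p hp
    obtain rfl | hp := hp.eq_or_lt
    · rw [hδ, Cochain.mk_v, Cochain.mk_v, dif_pos rfl, dif_neg (by omega)]
      simp [hs]
    · rw [← hα p hp, hδ, hδ, Cochain.mk_v, Cochain.mk_v, dif_neg (by omega), dif_neg (by omega)]

/-- A morphism from a bounded above complex of `n`-projective modules to an `n`-exact complex is
homotopic to zero. -/
lemma IsNExactComplex.nonempty_homotopy_zero {n : ℕ∞}
    {P Y : CochainComplex (ModuleCat.{u} R) ℤ} (b : ℤ) [P.IsStrictlyLE b]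
    (hP : ∀ j, IsNProjective n (P.X j)) (hY : IsNExactComplex n Y) (f : P ⟶ Y) :
    Nonempty (Homotopy f 0) := by
  let S (k : ℕ) := { α : Cochain P Y (-1) //
    ∀ p, b - k < p → (δ (-1) 0 α).v p p (add_zero p) = f.f p }
  have step (k : ℕ) (α : S k) : ∃ β : S (k + 1),
      ∀ p q (hpq : p + (-1) = q), b - k < p → β.1.v p q hpq = α.1.v p q hpq := by
    obtain ⟨β, h₁, h₂⟩ := hY.exists_extend_homotopy hP f α.1 (b - k) α.2
    exact ⟨⟨β, fun p hp => h₂ p (by push_cast at hp; omega)⟩, h₁⟩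
  choose next hnext using step
  -- Zero is a valid start because $P$ vanishes above $b$.
  let seq : ∀ k, S k := fun k => Nat.rec
    ⟨0, fun p hp => (P.isZero_of_isStrictlyLE b p (by simpa using hp)).eq_of_src _ _⟩ next k
  have hseq (k l : ℕ) (hkl : k ≤ l) (p q : ℤ) (hpq : p + (-1) = q) (hp : b - k < p) :
      (seq l).1.v p q hpq = (seq k).1.v p q hpq := by
    induction l, hkl using Nat.le_induction with
    | base => rfl
    | succ l hl ih => exact (hnext l (seq l) p q hpq (by omega)).trans ih
  -- Stage $b-p+1$ (stage $0$ if this is negative) is the first to control degree $p$. The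
  -- components in degrees $p$ and $p+1$ entering the homotopy relation at $p$ are then already
  -- final.
  let α : Cochain P Y (-1) := Cochain.mk fun p q hpq => (seq (b - p + 1).toNat).1.v p q hpq
  have hα (k : ℕ) (p q : ℤ) (hpq : p + (-1) = q) (hp : b - k < p) :
      α.v p q hpq = (seq k).1.v p q hpq := by
    rw [Cochain.mk_v]
    exact (hseq _ k (by omega) p q hpq (by omega)).symm
  refine ⟨(Cochain.equivHomotopy f 0).symm ⟨α, ?_⟩⟩
  rw [Cochain.ofHom_zero, add_zero]
  ext p : 1
  rw [Cochain.ofHom_v, ← (seq (b - p + 1).toNat).2 p (by omega),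
    δ_v (-1) 0 (neg_add_cancel 1) _ p p (add_zero p) (p - 1) (p + 1) rfl rfl,
    δ_v (-1) 0 (neg_add_cancel 1) _ p p (add_zero p) (p - 1) (p + 1) rfl rfl,
    hα (b - p + 1).toNat _ _ _ (by omega), hα (b - p + 1).toNat _ _ _ (by omega)]

/-- The vanishing of morphisms to `n`-exact complexes in the homotopy category can be checked
on the Hom complexes. -/
lemma leftOrthogonal_nExact_iff (n : ℕ∞) (P : CochainComplex (ModuleCat.{u} R) ℤ) :
    (nExact R n).leftOrthogonal ((HomotopyCategory.quotient _ _).obj P) ↔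
      ∀ Y : CochainComplex (ModuleCat.{u} R) ℤ, IsNExactComplex n Y →
        (HomComplex P Y).Acyclic := by
  -- $H^i\mathrm{Hom}(P,Y)$ is $\mathrm{Hom}_{K(R)}(P,Y[i])$.
  have hsub (Y : CochainComplex (ModuleCat.{u} R) ℤ) (i : ℤ) :
      (HomComplex P Y).ExactAt i ↔
        Subsingleton ((HomotopyCategory.quotient _ _).obj P ⟶
          (HomotopyCategory.quotient _ (ComplexShape.up ℤ)).obj (Y⟦i⟧)) := by
    rw [HomologicalComplex.exactAt_iff_isZero_homology,
      ← ((homologyAddEquiv P Y i).trans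
        (CohomologyClass.homAddEquiv (K := P) (L := Y) (n := i))).toEquiv.subsingleton_congr]
    exact ⟨fun h => AddCommGrpCat.subsingleton_of_isZero h,
      fun _ => AddCommGrpCat.isZero_of_subsingleton _⟩
  constructor
  · intro h Y hY i
    rw [hsub]
    have hYi : nExact R n ((HomotopyCategory.quotient _ _).obj (Y⟦i⟧)) :=
      ObjectProperty.prop_of_iso _
        (((HomotopyCategory.quotient _ (ComplexShape.up ℤ)).commShiftIso i).symm.app Y)
        (ObjectProperty.le_shift (nExact R n) i _
          (show nExact R n ((HomotopyCategory.quotient _ _).obj Y) from hY))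
    exact ⟨fun a b => (h a hYi).trans (h b hYi).symm⟩
  · intro h Y f hY
    obtain ⟨Y : CochainComplex _ _, rfl⟩ := Y.quotient_obj_surjective
    have h₀ := (hsub Y 0).1 (h Y hY 0)
    have e := (HomotopyCategory.quotient _ (ComplexShape.up ℤ)).mapIso
      ((shiftFunctorZero (CochainComplex (ModuleCat.{u} R) ℤ) ℤ).app Y)
    rw [← cancel_mono e.inv]
    exact Subsingleton.elim _ _

/-! ### Existence of `n`-projective resolutions of modules -/

/-- A criterion for `n`-quasi-isomorphisms, in terms of the components of the mapping cone. -/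
lemma isNQuasiIso_of_exists {n : ℕ∞} {X Y : CochainComplex (ModuleCat.{u} R) ℤ} (f : X ⟶ Y)
    (h : ∀ A : ModuleCat.{u} R, FinProjLE n A → ∀ i j k : ℤ, i + 1 = j → j + 1 = k →
      ∀ (α : A ⟶ X.X k) (β : A ⟶ Y.X j), α ≫ X.d k (k + 1) = 0 →
        α ≫ f.f k + β ≫ Y.d j k = 0 → ∃ (α' : A ⟶ X.X j) (β' : A ⟶ Y.X i),
          α' ≫ X.d j k = -α ∧ α' ≫ f.f j + β' ≫ Y.d i j = β) :
    IsNQuasiIso n f := by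
  refine (isNExactComplex_iff n _).2 fun A hA => (acyclic_homFrom_iff _ A).2 ?_
  intro i j k hij hjk φ hφ
  -- On components in $X^{j+1}$ and $Y^j$ the cone differential sends $(\alpha,\beta)$ to
  -- $(-d\alpha, f\alpha+d\beta)$, whence the sign in the hypothesis.
  obtain ⟨α', β', hα, hβ⟩ := h A hA i j k hij hjk (φ ≫ (mappingCone.fst f).1.v j k hjk)
    (φ ≫ (mappingCone.snd f).v j j (add_zero j)) (by
      have := hφ =≫ (mappingCone.fst f).1.v k (k + 1) rfl
      rw [Category.assoc, mappingCone.d_fst_v f j k (k + 1) hjk rfl, zero_comp] at this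
      simpa using this) (by
      have := hφ =≫ (mappingCone.snd f).v k k (add_zero k)
      rw [Category.assoc, mappingCone.d_snd_v f j k hjk, zero_comp] at this
      simpa using this)
  refine ⟨α' ≫ (mappingCone.inl f).v j i (by omega) + β' ≫ (mappingCone.inr f).f i, ?_⟩
  rw [mappingCone.ext_to_iff f j k hjk]
  constructor
  · simp [mappingCone.d_fst_v f i j k hij hjk, hα]
  · simp [mappingCone.d_snd_v f i j hij, hβ]

lemma isNQuasiIso_stalk_of_exists {n : ℕ∞} {P : CochainComplex (ModuleCat.{u} R) ℤ}
    [P.IsStrictlyLE 0] {M : ModuleCat.{u} R} (π : P ⟶ stalk M)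
    (h₀ : ∀ A : ModuleCat.{u} R, FinProjLE n A → ∀ φ : A ⟶ (stalk M).X 0,
      ∃ ψ : A ⟶ P.X 0, ψ ≫ π.f 0 = φ)
    (h₁ : ∀ A : ModuleCat.{u} R, FinProjLE n A → ∀ φ : A ⟶ P.X 0, φ ≫ π.f 0 = 0 →
      ∃ ψ : A ⟶ P.X (-1), ψ ≫ P.d (-1) 0 = φ)
    (h₂ : ∀ A : ModuleCat.{u} R, FinProjLE n A → ∀ (i j k : ℤ) (φ : A ⟶ P.X j),
      i + 1 = j → j + 1 = k → j < 0 → φ ≫ P.d j k = 0 → ∃ ψ : A ⟶ P.X i, ψ ≫ P.d i j = φ) :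
    IsNQuasiIso n π := by
  have hM (j : ℤ) (hj : j ≠ 0) : IsZero ((stalk M).X j) :=
    HomologicalComplex.isZero_single_obj_X _ _ _ _ hj
  have hP (j : ℤ) (hj : 0 < j) : IsZero (P.X j) := P.isZero_of_isStrictlyLE 0 j
  refine isNQuasiIso_of_exists π fun A hA i j k hij hjk α β hα hαβ => ?_
  -- In degree $j$ the cone has components $P^{j+1}$ and, only for $j=0$, $M$; so the hypotheses on
  -- $P^0\to M$, on $P^0$ and on negative degrees are used for $j=0$, $j=-1$ and $j<-1$.
  obtain hj | rfl | rfl | hj : 0 < j ∨ j = 0 ∨ j = -1 ∨ j < -1 := by omega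
  · exact ⟨0, 0, (hP k (by omega)).eq_of_tgt _ _, (hM j (by omega)).eq_of_tgt _ _⟩
  · obtain ⟨α', hα'⟩ := h₀ A hA β
    exact ⟨α', 0, (hP k (by omega)).eq_of_tgt _ _, by simpa using hα'⟩
  · obtain rfl : k = 0 := by omega
    obtain rfl : β = 0 := (hM (-1) (by omega)).eq_of_tgt _ _
    obtain ⟨α', hα'⟩ := h₁ A hA (-α) (by simpa using hαβ)
    exact ⟨α', 0, hα', (hM (-1) (by omega)).eq_of_tgt _ _⟩
  · obtain ⟨α', hα'⟩ := h₂ A hA j k (k + 1) (-α) hjk rfl (by omega) (by simpa using hα)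
    exact ⟨α', 0, hα', (hM j (by omega)).eq_of_tgt _ _⟩

/-- The resolution by covers, as a cochain complex indexed by `ℤ`. -/
def coverCochainComplex (n : ℕ∞) (M : ModuleCat.{u} R) : CochainComplex (ModuleCat.{u} R) ℤ :=
  (coverComplex n M).extend ComplexShape.embeddingDownNat

instance (n : ℕ∞) (M : ModuleCat.{u} R) : (coverCochainComplex n M).IsStrictlyLE 0 :=
  inferInstanceAs
    (CochainComplex.IsStrictlyLE ((coverComplex n M).extend ComplexShape.embeddingDownNat) 0)

/-- The modules of the resolution by covers. -/
def coverCochainComplexXIso (n : ℕ∞) (M : ModuleCat.{u} R) (k : ℕ) (j : ℤ) (h : -(k : ℤ) = j) :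
    (coverCochainComplex n M).X j ≅ (coverComplex n M).X k :=
  (coverComplex n M).extendXIso ComplexShape.embeddingDownNat h

lemma coverCochainComplex_d (n : ℕ∞) (M : ModuleCat.{u} R) (k l : ℕ) (i j : ℤ)
    (hk : -(k : ℤ) = i) (hl : -(l : ℤ) = j) :
    (coverCochainComplex n M).d i j = (coverCochainComplexXIso n M k i hk).hom ≫
      (coverComplex n M).d k l ≫ (coverCochainComplexXIso n M l j hl).inv :=
  (coverComplex n M).extend_d_eq ComplexShape.embeddingDownNat hk hl

lemma isNProjective_coverCochainComplex_X (n : ℕ∞) (M : ModuleCat.{u} R) (j : ℤ) :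
    IsNProjective n ((coverCochainComplex n M).X j) := by
  obtain hj | hj := lt_or_ge 0 j
  · exact .of_isZero ((coverCochainComplex n M).isZero_of_isStrictlyLE 0 j)
  · exact (isNProjective_coverComplex_X n M (-j).toNat).of_iso
      (coverCochainComplexXIso n M (-j).toNat j (by omega)).symm

/-- The module in degree `0` of a stalk complex. -/
def stalkXIso (M : ModuleCat.{u} R) : (stalk M).X 0 ≅ M :=
  HomologicalComplex.singleObjXSelf (ComplexShape.up ℤ) 0 M

/-- The augmentation of the resolution by covers. -/
def coverCochainComplexπ (n : ℕ∞) (M : ModuleCat.{u} R) : coverCochainComplex n M ⟶ stalk M :=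
  HomologicalComplex.mkHomToSingle
    ((coverCochainComplexXIso n M 0 0 (by simp)).hom ≫ coverComplexπ n M) (fun i hi => by
      obtain rfl : i = -1 := by simp at hi; omega
      rw [coverCochainComplex_d n M 1 0 (-1) 0 (by simp) (by simp)]
      simp [coverComplex_d_comp_π])

lemma coverCochainComplexπ_f (n : ℕ∞) (M : ModuleCat.{u} R) :
    (coverCochainComplexπ n M).f 0 = (coverCochainComplexXIso n M 0 0 (by simp)).hom ≫
      coverComplexπ n M ≫ (stalkXIso M).inv :=
  (HomologicalComplex.mkHomToSingle_f _ _).trans (Category.assoc _ _ _)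

lemma isNQuasiIso_coverCochainComplexπ (n : ℕ∞) (M : ModuleCat.{u} R) :
    IsNQuasiIso n (coverCochainComplexπ n M) := by
  refine isNQuasiIso_stalk_of_exists _ (fun A hA φ => ?_) (fun A hA φ hφ => ?_)
    (fun A hA i j k φ hij hjk hj hφ => ?_)
  · obtain ⟨ψ, hψ⟩ := hA.exists_lift_coverComplexπ
      (φ ≫ (stalkXIso M).hom)
    refine ⟨ψ ≫ (coverCochainComplexXIso n M 0 0 (by simp)).inv, ?_⟩
    simp [coverCochainComplexπ_f, reassoc_of% hψ]
  · obtain ⟨ψ, hψ⟩ := hA.exists_lift_coverComplex_d_one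
      (φ ≫ (coverCochainComplexXIso n M 0 0 (by simp)).hom) (by
        rw [← cancel_mono (stalkXIso M).inv]
        simpa [coverCochainComplexπ_f] using hφ)
    refine ⟨ψ ≫ (coverCochainComplexXIso n M 1 (-1) (by simp)).inv, ?_⟩
    simp [coverCochainComplex_d n M 1 0 (-1) 0 (by simp) (by simp), reassoc_of% hψ]
  · obtain ⟨l, rfl⟩ : ∃ l : ℕ, k = -l := ⟨(-k).toNat, by omega⟩
    have hj' : -((l + 1 : ℕ) : ℤ) = j := by push_cast; omega
    have hi' : -((l + 2 : ℕ) : ℤ) = i := by push_cast; omega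
    obtain ⟨ψ, hψ⟩ := hA.exists_lift_coverComplex_d l
      (φ ≫ (coverCochainComplexXIso n M (l + 1) j hj').hom) (by
        rw [← cancel_mono (coverCochainComplexXIso n M l _ rfl).inv]
        simpa [coverCochainComplex_d n M (l + 1) l j _ hj' rfl] using hφ)
    refine ⟨ψ ≫ (coverCochainComplexXIso n M (l + 2) i hi').inv, ?_⟩
    simp [coverCochainComplex_d n M (l + 2) (l + 1) i j hi' hj', reassoc_of% hψ]

lemma leftOrthogonal_nExact_of_isNProjective (n : ℕ∞) {P : CochainComplex (ModuleCat.{u} R) ℤ}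
    (b : ℤ) [P.IsStrictlyLE b] (hP : ∀ j, IsNProjective n (P.X j)) :
    (nExact R n).leftOrthogonal ((HomotopyCategory.quotient _ _).obj P) := by
  intro Y f hY
  obtain ⟨Y : CochainComplex _ _, rfl⟩ := Y.quotient_obj_surjective
  obtain ⟨f, rfl⟩ := (HomotopyCategory.quotient _ _).map_surjective f
  obtain ⟨h⟩ := IsNExactComplex.nonempty_homotopy_zero b hP hY f
  rw [HomotopyCategory.eq_of_homotopy f 0 h, Functor.map_zero]

/-- The `n`-projective resolution of a module by covers. -/
def coverResolution (n : ℕ∞) (M : ModuleCat.{u} R) : NProjectiveResolution n (stalk M) where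
  complex := coverCochainComplex n M
  isNProjective := isNProjective_coverCochainComplex_X n M
  acyclic_hom := (leftOrthogonal_nExact_iff n _).1
    (leftOrthogonal_nExact_of_isNProjective n 0 (isNProjective_coverCochainComplex_X n M))
  π := coverCochainComplexπ n M
  isNQuasiIso := isNQuasiIso_coverCochainComplexπ n M

instance (n : ℕ∞) (M : ModuleCat.{u} R) : (coverResolution n M).complex.IsStrictlyLE 0 :=
  inferInstanceAs ((coverCochainComplex n M).IsStrictlyLE 0)

/-! ### Comparison of the bounded derived category with a Verdier quotient of `K(R)` -/

variable (R) in
/-- The objects of `K(R)` which are bounded above complexes. -/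
def boundedAbove : ObjectProperty (K R) :=
  fun X => ∃ b : ℤ, CochainComplex.IsStrictlyLE X.as b

instance : (boundedAbove R).ContainsZero where
  exists_zero := ⟨(HomotopyCategory.quotient _ _).obj 0, Functor.map_isZero _ (isZero_zero _),
    ⟨0, inferInstanceAs (CochainComplex.IsStrictlyLE (0 : CochainComplex (ModuleCat.{u} R) ℤ) 0)⟩⟩

instance : (boundedAbove R).IsStableUnderShift ℤ where
  isStableUnderShiftBy n :=
    { le_shift := by
        intro X h
        obtain ⟨X : CochainComplex _ _, rfl⟩ := X.quotient_obj_surjective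
        obtain ⟨b, hb⟩ := h
        have : CochainComplex.IsStrictlyLE X b := hb
        rw [ObjectProperty.prop_shift_iff, HomotopyCategory.shift_quotient_obj]
        exact ⟨b - n, CochainComplex.isStrictlyLE_shift X b n (b - n) (by omega)⟩ }

lemma isStrictlyLE_mappingCone {X Y : CochainComplex (ModuleCat.{u} R) ℤ} (f : X ⟶ Y)
    (a b c : ℤ) [X.IsStrictlyLE a] [Y.IsStrictlyLE b] (ha : a ≤ c + 1) (hb : b ≤ c) :
    (mappingCone f).IsStrictlyLE c :=
  (CochainComplex.isStrictlyLE_iff _ _).2 fun i hi => (mappingCone.isZero_X_iff f i).2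
    ⟨X.isZero_of_isStrictlyLE a _ (by omega), Y.isZero_of_isStrictlyLE b _ (by omega)⟩

instance : (boundedAbove R).IsTriangulatedClosed₃ where
  ext₃' T hT h₁ h₂ := by
    obtain ⟨b₁, hb₁⟩ := h₁
    obtain ⟨b₂, hb₂⟩ := h₂
    obtain ⟨f : T.obj₁.as ⟶ T.obj₂.as, hf⟩ :=
      (HomotopyCategory.quotient _ _).map_surjective T.mor₁
    refine ⟨(HomotopyCategory.quotient _ _).obj (mappingCone f), ?_,
      ⟨Triangle.π₃.mapIso (isoTriangleOfIso₁₂ T _ hT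
        (HomotopyCategory.mappingCone_triangleh_distinguished f) (Iso.refl _) (Iso.refl _) ?_)⟩⟩
    · exact ⟨max b₁ b₂, isStrictlyLE_mappingCone f b₁ b₂ _ (by omega) (by omega)⟩
    · exact (Category.comp_id _).trans (hf.symm.trans (Category.id_comp _).symm)

instance : (boundedAbove R).IsTriangulated where
  toIsTriangulatedClosed₂ := .of_isTriangulatedClosed₃

variable (R) in
/-- The `n`-exact complexes which are homotopy equivalent to bounded above complexes. -/
abbrev nExactMinus (n : ℕ∞) : ObjectProperty (K R) :=
  nExact R n ⊓ (boundedAbove R).isoClosure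

/-- The canonical truncation of an `n`-exact complex is `n`-exact. -/
lemma IsNExactComplex.truncGE {n : ℕ∞} {X : CochainComplex (ModuleCat.{u} R) ℤ}
    (hX : IsNExactComplex n X) (c : ℤ) : IsNExactComplex n (X.truncGE c) := by
  refine (isNExactComplex_iff n _).2 fun A hA => (acyclic_homFrom_iff _ A).2 ?_
  intro i j k hij hjk φ hφ
  -- For $j\le c$ the preceding term is zero, so the outgoing differential is mono and $\varphi=0$.
  -- For $j>c$ the truncation map is an isomorphism in degrees $j$ and $j+1$, and the lift is found
  -- in $X$.
  obtain hj | hj := le_or_gt j c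
  · refine ⟨0, ?_⟩
    have hex : ((X.truncGE c).sc' i j k).Exact := by
      rw [← (X.truncGE c).exactAt_iff' i j k (by simp; omega) (by simp; omega)]
      exact hX.acyclic.truncGE _ j
    have : Mono ((X.truncGE c).sc' i j k).g := hex.mono_g
      (((X.truncGE c).isZero_of_isStrictlyGE c i (by omega)).eq_of_src _ _)
    have h0 : φ = 0 := by
      have : Mono ((X.truncGE c).d j k) := this
      rw [← cancel_mono ((X.truncGE c).d j k), hφ, zero_comp]
    rw [h0, zero_comp]
  · have hiso (p : ℤ) (hp : c < p) : IsIso ((X.πTruncGE c).f p) := by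
      obtain ⟨l, hl⟩ : ∃ l : ℕ, c + l = p := ⟨(p - c).toNat, by omega⟩
      refine (ComplexShape.Embedding.isIso_liftExtend_f_iff _ _
        (X.restrictionToTruncGE'_hasLift _)
        (show (ComplexShape.embeddingUpIntGE c).f l = p from hl)).2
        (X.isIso_restrictionToTruncGE' _ _ ?_)
      rw [ComplexShape.boundaryGE_embeddingUpIntGE_iff]
      omega
    have := hiso j hj
    have := hiso k (by omega)
    obtain ⟨ψ, hψ⟩ := (acyclic_homFrom_iff X A).1 ((isNExactComplex_iff n X).1 hX A hA) i j k
      hij hjk (φ ≫ inv ((X.πTruncGE c).f j)) (by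
        rw [← cancel_mono ((X.πTruncGE c).f k), Category.assoc, Category.assoc,
          ← (X.πTruncGE c).comm, IsIso.inv_hom_id_assoc, hφ, zero_comp])
    refine ⟨ψ ≫ (X.πTruncGE c).f i, ?_⟩
    rw [Category.assoc, (X.πTruncGE c).comm, reassoc_of% hψ, IsIso.inv_hom_id, Category.comp_id]

/-- A morphism from a bounded above `n`-exact complex to a bounded complex factors through a
bounded `n`-exact complex. -/
instance (n : ℕ∞) : (bounded R).IsVerdierRightLocalizing (nExactMinus R n) where
  fac {X Y} φ hX hY := by
    obtain ⟨hX, X', ⟨b, hb⟩, ⟨e⟩⟩ := hX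
    replace hX := ObjectProperty.prop_of_iso _ e hX
    obtain ⟨φ', rfl⟩ : ∃ φ', φ = e.hom ≫ φ' := ⟨e.inv ≫ φ, by simp⟩
    obtain ⟨X' : CochainComplex _ _, rfl⟩ := X'.quotient_obj_surjective
    obtain ⟨Y : CochainComplex _ _, rfl⟩ := Y.quotient_obj_surjective
    obtain ⟨⟨a, ha⟩, -⟩ := hY
    replace ha : Y.IsStrictlyGE a := ha
    replace hb : X'.IsStrictlyLE b := hb
    obtain ⟨φ', rfl⟩ := (HomotopyCategory.quotient _ _).map_surjective φ'
    have hle : (X'.truncGE a).IsStrictlyLE b := (isStrictlyLE_iff _ _).2 fun i hi => by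
      have : Epi ((X'.πTruncGE a).f i) :=
        inferInstanceAs (Epi ((HomologicalComplex.πTruncGE X'
          (ComplexShape.embeddingUpIntGE a)).f i))
      rw [IsZero.iff_id_eq_zero, ← cancel_epi ((X'.πTruncGE a).f i)]
      exact (X'.isZero_of_isStrictlyLE b i).eq_of_src _ _
    -- Since $Y$ lives in degrees $\ge a$, it equals its own truncation at $a$ up to isomorphism,
    -- and naturality of truncation gives the factorization.
    refine ⟨(HomotopyCategory.quotient _ _).obj (X'.truncGE a),
      e.hom ≫ (HomotopyCategory.quotient _ _).map (X'.πTruncGE a),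
      (HomotopyCategory.quotient _ _).map (truncGEMap φ' a ≫ inv (Y.πTruncGE a)),
      ⟨⟨a, inferInstanceAs ((X'.truncGE a).IsStrictlyGE a)⟩, b, hle⟩,
      ⟨IsNExactComplex.truncGE hX a, ObjectProperty.le_isoClosure _ _ ⟨b, hle⟩⟩, ?_⟩
    rw [Category.assoc, ← Functor.map_comp]
    simp

/-- The extra boundedness condition is automatic on $K^b(R)$, so $D^b_n(R)$ is also the source of
the comparison with the quotient by `nExactMinus`. -/
lemma inverseImage_nExactMinus (n : ℕ∞) :
    (nExactMinus R n).inverseImage (bounded R).ι = (nExact R n).inverseImage (bounded R).ι := by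
  ext X
  exact ⟨fun h => h.1, fun h => ⟨h, ObjectProperty.le_isoClosure _ _ X.property.2⟩⟩

instance (n : ℕ∞) : (nQuasiIso R n).Q.IsLocalization
    ((nExactMinus R n).inverseImage (bounded R).ι).trW := by
  rw [inverseImage_nExactMinus]
  infer_instance

/-- The functor from `D^b_n(R)` to the Verdier quotient of `K(R)` by the `n`-exact complexes which
are homotopy equivalent to bounded above complexes. -/
def toVerdierQuotient (n : ℕ∞) : Db R n ⥤ (nExactMinus R n).trW.Localization :=
  ((bounded R).triangulatedLocalizerMorphism (nExactMinus R n)).localizedFunctor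
    (nQuasiIso R n).Q (nExactMinus R n).trW.Q

instance (n : ℕ∞) : (toVerdierQuotient (R := R) n).Full := by
  unfold toVerdierQuotient; infer_instance

instance (n : ℕ∞) : (toVerdierQuotient (R := R) n).Faithful := by
  unfold toVerdierQuotient; infer_instance

instance (n : ℕ∞) : (toVerdierQuotient (R := R) n).Additive := by
  unfold toVerdierQuotient; infer_instance

/-- The compatibility of `toVerdierQuotient` with the localization functors. -/
def toVerdierQuotientIso (n : ℕ∞) :
    (nQuasiIso R n).Q ⋙ toVerdierQuotient n ≅ (bounded R).ι ⋙ (nExactMinus R n).trW.Q :=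
  letI : CatCommSq ((bounded R).triangulatedLocalizerMorphism (nExactMinus R n)).functor
      (nQuasiIso R n).Q (nExactMinus R n).trW.Q (toVerdierQuotient n) :=
    inferInstanceAs (CatCommSq _ _ _ (((bounded R).triangulatedLocalizerMorphism
      (nExactMinus R n)).localizedFunctor (nQuasiIso R n).Q (nExactMinus R n).trW.Q))
  (CatCommSq.iso ((bounded R).triangulatedLocalizerMorphism (nExactMinus R n)).functor
    (nQuasiIso R n).Q (nExactMinus R n).trW.Q (toVerdierQuotient n)).symm

/-- The additive bijection on morphisms induced by isomorphisms on sources and targets. -/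
def homAddEquivOfIso {C : Type*} [Category* C] [Preadditive C] {X Y X' Y' : C} (e : X ≅ X')
    (f : Y ≅ Y') : (X ⟶ Y) ≃+ (X' ⟶ Y') where
  toEquiv := e.homCongr f
  map_add' := by simp

/-- Morphisms in `D^b_n(R)` from a bounded complex can be computed in `K(R)` using a
bounded above complex which is left orthogonal to the `n`-exact complexes. -/
def homAddEquivDb {n : ℕ∞} {P : K R} (hP : (nExact R n).leftOrthogonal P) {X : Kb R}
    (π : P ⟶ X.obj) (hπ : (nExactMinus R n).trW π) (Y : Kb R) :
    (P ⟶ Y.obj) ≃+ ((nQuasiIso R n).Q.obj X ⟶ (nQuasiIso R n).Q.obj Y) :=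
  have : IsIso ((nExactMinus R n).trW.Q.map π) := Localization.inverts _ _ _ hπ
  have hP' : (nExactMinus R n).leftOrthogonal P := fun _ f h => hP f h.1
  -- Orthogonality identifies morphisms out of $P$ with those in the quotient, $\pi$ becomes
  -- invertible there, and full faithfulness returns to $D^b_n(R)$.
  (AddEquiv.ofBijective ((nExactMinus R n).trW.Q.mapAddHom (X := P) (Y := Y.obj))
    (hP'.map_bijective_of_isTriangulated (nExactMinus R n).trW.Q Y.obj)).trans <|
  (homAddEquivOfIso (asIso ((nExactMinus R n).trW.Q.map π) ≪≫
    ((toVerdierQuotientIso n).app X).symm) ((toVerdierQuotientIso n).app Y).symm).trans <|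
  (AddEquiv.ofBijective ((toVerdierQuotient n).mapAddHom
    (X := (nQuasiIso R n).Q.obj X) (Y := (nQuasiIso R n).Q.obj Y))
    ((Functor.FullyFaithful.ofFullyFaithful (toVerdierQuotient n)).map_bijective _ _)).symm

/-! ### Comparison of resolutions -/

lemma IsNQuasiIso.trW {n : ℕ∞} {X Y : CochainComplex (ModuleCat.{u} R) ℤ} {f : X ⟶ Y}
    (hf : IsNQuasiIso n f) : (nExact R n).trW ((HomotopyCategory.quotient _ _).map f) :=
  ObjectProperty.trW.mk _ (HomotopyCategory.mappingCone_triangleh_distinguished f) hf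

lemma NProjectiveResolution.leftOrthogonal {n : ℕ∞} {X : CochainComplex (ModuleCat.{u} R) ℤ}
    (P : NProjectiveResolution n X) :
    (nExact R n).leftOrthogonal ((HomotopyCategory.quotient _ _).obj P.complex) :=
  (leftOrthogonal_nExact_iff n _).2 P.acyclic_hom

/-- Two `n`-projective resolutions are homotopy equivalent. -/
lemma NProjectiveResolution.nonempty_iso {n : ℕ∞} {X : CochainComplex (ModuleCat.{u} R) ℤ}
    (P P' : NProjectiveResolution n X) :
    Nonempty ((HomotopyCategory.quotient _ (ComplexShape.up ℤ)).obj P.complex ≅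
      (HomotopyCategory.quotient _ _).obj P'.complex) := by
  have hP := P.leftOrthogonal
  have hP' := P'.leftOrthogonal
  -- Orthogonality means that composition with an $n$-quasi-isomorphism is bijective on maps out of
  -- $P$ and $P'$: surjectivity lifts each augmentation through the other, injectivity makes the
  -- lifts mutually inverse.
  rw [← ObjectProperty.isColocal_trW] at hP hP'
  obtain ⟨f, hf⟩ := (hP _ P'.isNQuasiIso.trW).2 ((HomotopyCategory.quotient _ _).map P.π)
  obtain ⟨g, hg⟩ := (hP' _ P.isNQuasiIso.trW).2 ((HomotopyCategory.quotient _ _).map P'.π)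
  dsimp only at hf hg
  exact ⟨⟨f, g, (hP _ P.isNQuasiIso.trW).1 (by simp [hf, hg]),
    (hP' _ P'.isNQuasiIso.trW).1 (by simp [hf, hg])⟩⟩

/-- The cone is bounded above because the cover resolution lives in degrees $\le 0$; an arbitrary
resolution need not have this property, so it is first replaced by this one. -/
lemma coverResolution_trW (n : ℕ∞) (M : ModuleCat.{u} R) :
    (nExactMinus R n).trW ((HomotopyCategory.quotient _ _).map (coverResolution n M).π) :=
  have : (stalk M).IsStrictlyLE 0 := inferInstance
  ObjectProperty.trW.mk _ (HomotopyCategory.mappingCone_triangleh_distinguished _)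
    ⟨(coverResolution n M).isNQuasiIso, ObjectProperty.le_isoClosure _ _
      ⟨0, isStrictlyLE_mappingCone (coverResolution n M).π 0 0 0 (by omega) le_rfl⟩⟩

/-- The comparison of the relative `Ext` groups with the morphisms in `D^b_n(R)`. -/
def nExtAddEquiv {n : ℕ∞} {M : ModuleCat.{u} R} (P : NProjectiveResolution n (stalk M))
    (N : ModuleCat.{u} R) (i : ℤ) :
    P.nExt (stalk N) i ≃+ (stalkDb n M ⟶ (stalkDb n N)⟦i⟧) :=
  ((homologyAddEquiv P.complex (stalk N) i).trans
    (CohomologyClass.homAddEquiv (K := P.complex) (L := stalk N) (n := i))).trans <|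
  (homAddEquivOfIso (P.nonempty_iso (coverResolution n M)).some
    (((HomotopyCategory.quotient _ (ComplexShape.up ℤ)).commShiftIso i).app (stalk N) ≪≫
      (((bounded R).ι.commShiftIso i).app (stalkKb N)).symm)).trans <|
  (homAddEquivDb (X := stalkKb M) (coverResolution n M).leftOrthogonal
    ((HomotopyCategory.quotient _ _).map (coverResolution n M).π) (coverResolution_trW n M)
    ((stalkKb N)⟦i⟧)).trans <|
  homAddEquivOfIso (Iso.refl _) (((nQuasiIso R n).Q.commShiftIso i).app (stalkKb N))

end NDerived

end

theorem proposition3p8 {R : Type u} [Ring R] (n : ℕ∞) (M N : ModuleCat.{u} R) (i : ℤ) :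
    Nonempty (NDerived.NProjectiveResolution n (NDerived.stalk M)) ∧
    ∀ P : NDerived.NProjectiveResolution n (NDerived.stalk M),
      Nonempty (P.nExt (NDerived.stalk N) i ≃+
        (NDerived.stalkDb n M ⟶ (NDerived.stalkDb n N)⟦i⟧)) := by
  exact ⟨⟨NDerived.coverResolution n M⟩, fun P => ⟨NDerived.nExtAddEquiv P N i⟩⟩
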